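/- Let $G=(\Sigma,\mathcal N,S,\mathcal R,p)$ be a stochastic context-free grammar with nonterminals $\mathcal N=\{A_1,\dots,A_N\}$, start symbol $S=A_1$, a finite set $\mathcal R$ of rules, and rule weights $p:\mathcal R\to[0,1]$; write $A_i\to B_{i,j}$ ($1\le j\le|\mathcal R_i|$) for the rules with premise $A_i$ and $r_n(i,j)$ for the number of occurrences of $A_n$ in $B_{i,j}$. Assume that $G$ is reduced (all rules have positive weight, and every nonterminal is accessible from $S$ and productive) and proper ($\sum_j p(A_i\to B_{i,j})=1$ for every $i$), and that the expectation matrix $M$, $M_{i,n}=\sum_{j}p(A_i\to B_{i,j})\,r_n(i,j)$, has spectral radius $\rho(M)<1$. Let $\Omega_i$ be the set of left-most derivations $\pi=\pi_1\cdots\pi_K$ (strings of rules) that lead from $A_i$ to a string of terminals, and put $p(\pi)=\prod_k p(\pi_k)$. For $Y:\mathcal R\to\mathbb R$ put $X(\pi)=\sum_k Y(\pi_k)$ and $m^{(\alpha)}_i=\sum_{\pi\in\Omega_i}p(\pi)X(\pi)^\alpha$, and let $m^{(\alpha)}=(m^{(\alpha)}_1,\dots,m^{(\alpha)}_N)^T$.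 For $\alpha,\beta\in\mathbb N_0$ with $\beta\le\alpha$ and $\gamma\in\mathbb N_0^N$ define $$H_{i,j}(\gamma)=\binom{\gamma_1+\cdots+\gamma_N}{\gamma_1,\dots,\gamma_N}\prod_{k=1}^N\ \sum_{\delta_1+\cdots+\delta_{r_k(i,j)}=\gamma_k}\binom{\gamma_k}{\delta_1,\dots,\delta_{r_k(i,j)}}\prod_{l=1}^{r_k(i,j)}m^{(\delta_l)}_k,$$ $$Q_{i,j}(\alpha,\beta)=\binom{\alpha}{\beta}\,p(A_i\to B_{i,j})\,Y(A_i\to B_{i,j})^{\alpha-\beta}\sum_{\gamma_1+\cdots+\gamma_N=\beta}H_{i,j}(\gamma)$$ (with $x^0=1$), and $$c^{(\alpha)}_i=\sum_j p(A_i\to B_{i,j})\sum_{n=1}^N\ \sum_{\substack{\delta_1+\cdots+\delta_{r_n(i,j)}=\alpha\\ \text{all }\delta_l<\alpha}}\binom{\alpha}{\delta_1,\dots,\delta_{r_n(i,j)}}\prod_{l}m^{(\delta_l)}_n+\sum_j p(A_i\to B_{i,j})\sum_{\substack{\gamma_1+\cdots+\gamma_N=\alpha\\ \text{all }\gamma_k<\alpha}}H_{i,j}(\gamma)+\sum_j\sum_{\beta<\alpha}Q_{i,j}(\alpha,\beta).$$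 Then $\sum_{\pi\in\Omega_i}p(\pi)=1$ for every $i$, the series defining $m^{(1)}_i$ and $m^{(2)}_i$ converge absolutely, $I-M$ is invertible, and the following hold. 1. (First order.) $c^{(1)}_i=\sum_j p(A_i\to B_{i,j})\,Y(A_i\to B_{i,j})$ and $m^{(1)}=(I-M)^{-1}c^{(1)}$. 2. (Second order.) For every $i$, $$c^{(2)}_i=CR_i+\sum_jQ_{i,j}(2,0)+\sum_jQ_{i,j}(2,1),$$ where $$CR_i=\sum_jp(A_i\to B_{i,j})\sum_{a=1}^N\sum_{b=1}^Nr_a(i,j)\,r_b(i,j)\,m^{(1)}_am^{(1)}_b-\sum_jp(A_i\to B_{i,j})\sum_{n=1}^Nr_n(i,j)\big(m^{(1)}_n\big)^2,$$ $$Q_{i,j}(2,0)=p(A_i\to B_{i,j})\,Y(A_i\to B_{i,j})^2,\qquad Q_{i,j}(2,1)=2\,p(A_i\to B_{i,j})\,Y(A_i\to B_{i,j})\sum_{n=1}^Nr_n(i,j)\,m^{(1)}_n,$$ and $m^{(2)}=(I-M)^{-1}c^{(2)}$. 3. (Derivation length.) If $Y\equiv1$ on $\mathcal R$, then $X(\pi)$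 is the length of the derivation $\pi$, so that $m^{(1)}_i$ is the expected length of the derivations starting at $A_i$, and $m^{(1)}=(I-M)^{-1}\mathbf 1$. Moreover $\sum_jQ_{i,j}(2,0)=1$, $\sum_jQ_{i,j}(2,1)=2m^{(1)}_i-2$, $c^{(2)}_i=CR_i+2m^{(1)}_i-1$, and $$m^{(2)}=(I-M)^{-1}\big(CR+2m^{(1)}-\mathbf 1\big).$$ 4. (String length.) If $Y(A_i\to B_{i,j})=t(i,j)$ is the number of terminals in $B_{i,j}$ for every rule, then $X(\pi)$ is the length of the string derived by $\pi$, so that $m^{(1)}_i$ is the expected length of the string derived from $A_i$, and $m^{(1)}=(I-M)^{-1}\big(\sum_jp(A_i\to B_{i,j})\,t(i,j)\big)_{i}$. -/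

import Mathlib

/-- A stochastic context-free grammar: a context-free grammar with a weight in `[0, 1]` on each of
its (finitely many) rules. The values of `p` outside `rules` are never used. -/
structure StochasticCFG (T : Type*) extends ContextFreeGrammar T where
  /-- The weight of a rule. -/
  p : ContextFreeRule T NT → ℝ
  p_nonneg : ∀ r ∈ rules, 0 ≤ p r
  p_le_one : ∀ r ∈ rules, p r ≤ 1

namespace StochasticCFG

variable {T : Type*} (G : StochasticCFG T)

/-- The left-most rewriting relation: `r : A → γ` is a rule and `a = u A δ`, `b = u γ δ` for some
string `u` of terminals. -/
def LeftmostStep (a : List (Symbol T G.NT)) (r : ContextFreeRule T G.NT)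
    (b : List (Symbol T G.NT)) : Prop :=
  r ∈ G.rules ∧ ∃ (u : List T) (δ : List (Symbol T G.NT)),
    a = u.map Symbol.terminal ++ [Symbol.nonterminal r.input] ++ δ ∧
    b = u.map Symbol.terminal ++ r.output ++ δ

/-- `G.Derives a π b`: applying the rules of the list `π` successively, by left-most rewriting,
leads from `a` to `b`. -/
inductive Derives : List (Symbol T G.NT) → List (ContextFreeRule T G.NT) →
    List (Symbol T G.NT) → Prop
  | nil (a : List (Symbol T G.NT)) : Derives a [] a
  | cons {a b c : List (Symbol T G.NT)} {r : ContextFreeRule T G.NT}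
      {π : List (ContextFreeRule T G.NT)} :
      G.LeftmostStep a r b → Derives b π c → Derives a (r :: π) c

/-- A nonterminal is productive if some string of terminals can be derived from it. -/
def Productive (A : G.NT) : Prop :=
  ∃ (π : List (ContextFreeRule T G.NT)) (u : List T),
    G.Derives [Symbol.nonterminal A] π (u.map Symbol.terminal)

/-- A nonterminal is accessible if it occurs in a string derived from the start symbol. -/
def Accessible (A : G.NT) : Prop :=
  ∃ (π : List (ContextFreeRule T G.NT)) (η ξ : List (Symbol T G.NT)),
    G.Derives [Symbol.nonterminal G.initial] π (η ++ [Symbol.nonterminal A] ++ ξ)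

/-- All rules have positive weight and all nonterminals are useful. -/
def IsReduced : Prop :=
  (∀ r ∈ G.rules, 0 < G.p r) ∧ ∀ A : G.NT, G.Accessible A ∧ G.Productive A

/-- `G.Ω i` is the set of complete left-most derivations (as strings of rules) starting at `i`,
that is, of those that end in a string of terminals. -/
def Ω (i : G.NT) : Set (List (ContextFreeRule T G.NT)) :=
  {π | ∃ u : List T, G.Derives [Symbol.nonterminal i] π (u.map Symbol.terminal)}

/-- The string of terminals derived by a complete derivation. -/
noncomputable def yield {i : G.NT} (π : G.Ω i) : List T := π.2.choose

/-- The weight of a string of rules. -/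
noncomputable def weight (π : List (ContextFreeRule T G.NT)) : ℝ := (π.map G.p).prod

/-- The additive extension of `Y` from rules to strings of rules. -/
noncomputable def X (Y : ContextFreeRule T G.NT → ℝ) (π : List (ContextFreeRule T G.NT)) : ℝ :=
  (π.map Y).sum

/-- The moment of order `α` of `X` with respect to the derivations that start at `i`. -/
noncomputable def moment (Y : ContextFreeRule T G.NT → ℝ) (α : ℕ) (i : G.NT) : ℝ :=
  ∑' π : G.Ω i, G.weight π * G.X Y π ^ α

/-- The number of terminals on the right-hand side of a rule. -/
def terminalCount (r : ContextFreeRule T G.NT) : ℕ :=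
  r.output.countP fun s => match s with
    | Symbol.terminal _ => true
    | Symbol.nonterminal _ => false

section

variable [DecidableEq G.NT]

/-- The rules with premise `i`. -/
def rulesOf (i : G.NT) : Finset (ContextFreeRule T G.NT) :=
  G.rules.filter fun r => r.input = i

/-- The weights of the rules with a given premise form a probability distribution. -/
def IsProper : Prop := ∀ i : G.NT, ∑ r ∈ G.rulesOf i, G.p r = 1

variable [DecidableEq T]

/-- The number of occurrences of the nonterminal `n` on the right-hand side of the rule. -/
def ntCount (n : G.NT) (r : ContextFreeRule T G.NT) : ℕ :=
  r.output.count (Symbol.nonterminal n)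

/-- The expectation matrix `M`. -/
noncomputable def expMatrix : Matrix G.NT G.NT ℝ :=
  Matrix.of fun i n => ∑ r ∈ G.rulesOf i, G.p r * (G.ntCount n r : ℝ)

variable [Fintype G.NT]

/-- `H(γ₁, …, γ_N)` for the rule `r`: the multinomial coefficient of the `γ`s times
`∏ₖ ∑_{δ₁ + ⋯ + δ_{rₖ} = γₖ} (γₖ; δ₁, …, δ_{rₖ}) ∏ₗ mₖ^(δₗ)`. -/
noncomputable def H (Y : ContextFreeRule T G.NT → ℝ) (r : ContextFreeRule T G.NT)
    (γ : G.NT → ℕ) : ℝ :=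
  (Nat.multinomial Finset.univ γ : ℝ) *
    ∏ k : G.NT, ∑ δ ∈ Finset.piAntidiag (Finset.univ : Finset (Fin (G.ntCount k r))) (γ k),
      (Nat.multinomial Finset.univ δ : ℝ) * ∏ l, G.moment Y (δ l) k

/-- The term `Q(α, β)` for the rule `r`. -/
noncomputable def Q (Y : ContextFreeRule T G.NT → ℝ) (r : ContextFreeRule T G.NT)
    (α β : ℕ) : ℝ :=
  (α.choose β : ℝ) * G.p r * Y r ^ (α - β) *
    ∑ γ ∈ Finset.piAntidiag (Finset.univ : Finset G.NT) β, G.H Y r γ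

/-- The inhomogeneous term `c^(α)` of the linear system for the moments of order `α`. -/
noncomputable def c (Y : ContextFreeRule T G.NT → ℝ) (α : ℕ) (i : G.NT) : ℝ :=
  ∑ r ∈ G.rulesOf i, G.p r *
      ∑ n : G.NT, ∑ δ ∈ (Finset.piAntidiag
          (Finset.univ : Finset (Fin (G.ntCount n r))) α).filter fun δ => ∀ l, δ l < α,
        (Nat.multinomial Finset.univ δ : ℝ) * ∏ l, G.moment Y (δ l) n
  + ∑ r ∈ G.rulesOf i, G.p r *
      ∑ γ ∈ (Finset.piAntidiag (Finset.univ : Finset G.NT) α).filter fun γ => ∀ k, γ k < α,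
        G.H Y r γ
  + ∑ r ∈ G.rulesOf i, ∑ β ∈ Finset.range α, G.Q Y r α β

/-- The term `CR`, a function of the first moments. -/
noncomputable def CR (Y : ContextFreeRule T G.NT → ℝ) (i : G.NT) : ℝ :=
  ∑ r ∈ G.rulesOf i, G.p r *
      ∑ a : G.NT, ∑ b : G.NT,
        (G.ntCount a r : ℝ) * (G.ntCount b r : ℝ) * (G.moment Y 1 a * G.moment Y 1 b)
  - ∑ r ∈ G.rulesOf i, G.p r * ∑ n : G.NT, (G.ntCount n r : ℝ) * G.moment Y 1 n ^ 2

end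

end StochasticCFG

/-! A left-most derivation is a branching process run depth first. Left-most rewriting makes a
complete derivation from a concatenation `s ++ d` split uniquely into one from `s` followed by one
from `d` (`bijective_append_completions`). Since weights multiply and `X` adds, the parts behave as
independent variables once the total mass is one: means and variances are additive over the symbols
of a string (`hasSum_moments`). Conditioning on the first rule then gives m = b + M m for the first
two moments, and inverting `1 - M` solves it.

These manipulations need convergence first, and that comes from ρ(M) < 1. The inverse of `1 - M` is
the limit of the geometric sums of M, hence nonnegative, so h = (1 - M)⁻¹ 1 is a nonnegative
solution of h = 1 + M h. Extended additively to strings, h drops by exactly one in expectation at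
each step. A linear drift argument on derivations of length at most N gives total mass one
(`hasSum_weight`); a quadratic Lyapunov function gives a second moment of the length
(`summable_weight_mul_sq`), which dominates `X` and `X ^ 2` because the rules are finite in number.

The rest is algebra: with zeroth moment one, the multinomial sums in `H`, `Q` and `c` of order at
most two collapse to powers of sums. -/

/-! ### Nonnegative matrices of spectral radius below one -/

open Filter Topology in
/-- If a nonnegative real matrix has spectral radius less than one, then `1 - M` is invertible and
its inverse is nonnegative. -/
theorem Matrix.isUnit_one_sub_and_inv_nonneg {n : Type*} [Fintype n] [DecidableEq n]
    (M : Matrix n n ℝ) (hM : spectralRadius ℂ (M.map (fun x : ℝ => (x : ℂ))) < 1)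
    (h0 : ∀ i j, 0 ≤ M i j) :
    IsUnit (1 - M) ∧ ∀ i j, 0 ≤ (1 - M)⁻¹ i j := by
  let _ := Matrix.linftyOpNormedRing (n := n) (α := ℂ)
  let _ := Matrix.linftyOpNormedAlgebra (n := n) (R := ℂ) (α := ℂ)
  set C : Matrix n n ℂ := M.map (fun x : ℝ => (x : ℂ)) with hC
  have hCof : C = (algebraMap ℝ ℂ).mapMatrix M := rfl
  have hunit : IsUnit (1 - M) := by
    have h1 : (1 : ℂ) ∈ resolventSet ℂ C :=
      spectrum.mem_resolventSet_of_spectralRadius_lt (by simpa using hM)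
    have h2 : IsUnit (1 - C) := by simpa [spectrum.mem_resolventSet_iff] using h1
    have h3 : 1 - C = (algebraMap ℝ ℂ).mapMatrix (1 - M) := by rw [map_sub, map_one, hCof]
    rw [Matrix.isUnit_iff_isUnit_det, isUnit_iff_ne_zero] at h2 ⊢
    rw [h3, ← RingHom.map_det] at h2
    intro h
    exact h2 (by rw [h, map_zero])
  have hpow : Tendsto (fun k : ℕ => M ^ k) atTop (𝓝 0) := by
    -- Gelfand's formula: for r strictly between the spectral radius and 1, the norm of `C ^ k` is
    -- eventually at most r ^ k.
    obtain ⟨r, hr, hr1⟩ := ENNReal.lt_iff_exists_nnreal_btwn.1 hM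
    have hg := spectrum.pow_nnnorm_pow_one_div_tendsto_nhds_spectralRadius C
    have hev : ∀ᶠ k : ℕ in atTop, ‖C ^ k‖ ≤ (r : ℝ) ^ k := by
      filter_upwards [hg.eventually_lt_const hr, eventually_ge_atTop 1] with k hk hk1
      have h4 : ((‖C ^ k‖₊ : ENNReal)) ≤ (r : ENNReal) ^ k := by
        have h5 := ENNReal.rpow_le_rpow hk.le (Nat.cast_nonneg k)
        rwa [← ENNReal.rpow_mul, one_div, inv_mul_cancel₀ (by positivity), ENNReal.rpow_one,
          ENNReal.rpow_natCast] at h5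
      exact_mod_cast h4
    have hr1' : (r : ℝ) < 1 := by exact_mod_cast hr1
    have hzero : Tendsto (fun k : ℕ => ‖C ^ k‖) atTop (𝓝 0) :=
      squeeze_zero' (Eventually.of_forall fun _ => norm_nonneg _) hev
        (tendsto_pow_atTop_nhds_zero_of_lt_one r.2 hr1')
    refine tendsto_pi_nhds.2 fun i => tendsto_pi_nhds.2 fun j => ?_
    refine squeeze_zero_norm (fun k => ?_) hzero
    have h6 : C ^ k = (algebraMap ℝ ℂ).mapMatrix (M ^ k) := by rw [map_pow, hCof]
    have h7 : ‖(M ^ k) i j‖₊ ≤ ‖C ^ k‖₊ := by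
      rw [Matrix.linfty_opNNNorm_def]
      refine le_trans ?_ (Finset.le_sup (f := fun i => ∑ j, ‖(C ^ k) i j‖₊) (Finset.mem_univ i))
      refine le_trans ?_ (Finset.single_le_sum (f := fun j => ‖(C ^ k) i j‖₊)
        (fun _ _ => zero_le) (Finset.mem_univ j))
      rw [h6]
      simp
    exact h7
  refine ⟨hunit, fun i j => ?_⟩
  have hdet := (Matrix.isUnit_iff_isUnit_det _).1 hunit
  have hgeom : ∀ k : ℕ, ∑ l ∈ Finset.range k, M ^ l = (1 - M)⁻¹ * (1 - M ^ k) := fun k => by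
    rw [← mul_neg_geom_sum, ← mul_assoc, Matrix.nonsing_inv_mul _ hdet, one_mul]
  have hlim : Tendsto (fun k : ℕ => (∑ l ∈ Finset.range k, M ^ l) i j) atTop
      (𝓝 ((1 - M)⁻¹ i j)) := by
    simp_rw [hgeom]
    have h8 : Tendsto (fun k : ℕ => (1 - M)⁻¹ * (1 - M ^ k)) atTop (𝓝 ((1 - M)⁻¹ * (1 - 0))) :=
      (tendsto_const_nhds.sub hpow).const_mul _
    rw [sub_zero, mul_one] at h8
    exact (tendsto_pi_nhds.1 (tendsto_pi_nhds.1 h8 i)) j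
  have hpn : ∀ (k : ℕ) (i j), 0 ≤ (M ^ k) i j := by
    intro k
    induction k with
    | zero => intro i j; rw [pow_zero, Matrix.one_apply]; split_ifs <;> norm_num
    | succ k ih =>
      intro i j
      rw [pow_succ, Matrix.mul_apply]
      exact Finset.sum_nonneg fun l _ => mul_nonneg (ih i l) (h0 l j)
  refine ge_of_tendsto' hlim fun k => ?_
  rw [Matrix.sum_apply]
  exact Finset.sum_nonneg fun l _ => hpn l i j

/-! ### Multinomial sums of order at most two -/

section PiAntidiag

variable {ι : Type*} [Fintype ι]

theorem Finset.piAntidiag_univ_filter_two [DecidableEq ι]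
    [DecidablePred fun γ : ι → ℕ => ¬ ∀ k, γ k < 2] :
    (Finset.piAntidiag (Finset.univ : Finset ι) 2).filter (fun γ => ¬ ∀ k, γ k < 2) =
      Finset.univ.image fun k : ι => Pi.single k 2 := by
  ext γ
  simp only [Finset.mem_filter, Finset.mem_piAntidiag, Finset.mem_image, Finset.mem_univ, true_and,
    not_forall, not_lt, implies_true, and_true]
  constructor
  · rintro ⟨hsum, k, hk⟩
    refine ⟨k, ?_⟩
    rw [← Finset.add_sum_erase _ _ (Finset.mem_univ k)] at hsum
    have hz : ∑ x ∈ Finset.univ.erase k, γ x = 0 := by omega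
    ext l
    rcases eq_or_ne l k with rfl | hl
    · rw [Pi.single_eq_same]; omega
    · rw [Pi.single_eq_of_ne hl]
      exact ((Finset.sum_eq_zero_iff.1 hz) l (by simp [hl])).symm
  · rintro ⟨k, rfl⟩
    exact ⟨by simp, k, by simp⟩

/-- The mixed terms of the square of a sum. -/
theorem Finset.sum_piAntidiag_two_filter [DecidableEq ι]
    [DecidablePred fun γ : ι → ℕ => ∀ k, γ k < 2] (x : ι → ℝ) :
    ∑ γ ∈ (Finset.piAntidiag (Finset.univ : Finset ι) 2).filter (fun γ => ∀ k, γ k < 2),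
      (Nat.multinomial Finset.univ γ : ℝ) * ∏ k, x k ^ γ k =
      (∑ k, x k) ^ 2 - ∑ k, x k ^ 2 := by
  rw [Finset.sum_pow_eq_sum_piAntidiag, eq_sub_iff_add_eq,
    ← Finset.sum_filter_add_sum_filter_not (Finset.piAntidiag _ _)
      (fun γ : ι → ℕ => ∀ k, γ k < 2)]
  -- The excluded exponents have a single entry 2, with multinomial coefficient 1, and contribute
  -- the pure squares.
  congr 1
  rw [Finset.piAntidiag_univ_filter_two, Finset.sum_image]
  · refine Finset.sum_congr rfl fun k _ => ?_
    have h1 : Nat.multinomial Finset.univ (Pi.single k 2 : ι → ℕ) = 1 := by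
      have h2 := Nat.multinomial_spec (Finset.univ : Finset ι) (Pi.single k 2 : ι → ℕ)
      rw [← Finset.mul_prod_erase _ _ (Finset.mem_univ k), Finset.prod_eq_one] at h2
      · simpa using h2
      · intro l hl
        rw [Pi.single_eq_of_ne (Finset.ne_of_mem_erase hl), Nat.factorial_zero]
    rw [h1, Finset.prod_eq_single k]
    · simp
    · intro l _ hl
      simp [Pi.single_eq_of_ne hl]
    · simp
  · intro a _ b _ hab
    by_contra hne
    have := congrFun hab a
    simp [Pi.single_eq_of_ne hne] at this

theorem Finset.prod_apply_eq_prod_pow {m : ℕ → ι → ℝ} (hm : ∀ k, m 0 k = 1) {γ : ι → ℕ}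
    (hγ : ∀ k, γ k < 2) : ∏ k, m (γ k) k = ∏ k, m 1 k ^ γ k := by
  refine Finset.prod_congr rfl fun k _ => ?_
  have := hγ k
  interval_cases h : γ k <;> simp [hm]

theorem Finset.lt_two_of_mem_piAntidiag_univ [DecidableEq ι] {γ : ι → ℕ} {n : ℕ}
    (hγ : γ ∈ Finset.piAntidiag (Finset.univ : Finset ι) n) (hn : n < 2) (k : ι) : γ k < 2 := by
  have hsum := (Finset.mem_piAntidiag.1 hγ).1
  exact ((Finset.single_le_sum (f := γ) (fun _ _ => Nat.zero_le _)
    (Finset.mem_univ k)).trans_eq hsum).trans_lt hn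

theorem Finset.filter_piAntidiag_univ_one [DecidableEq ι]
    [DecidablePred fun δ : ι → ℕ => ∀ l, δ l < 1] :
    (Finset.piAntidiag (Finset.univ : Finset ι) 1).filter (fun δ => ∀ l, δ l < 1) = ∅ := by
  refine Finset.filter_eq_empty_iff.2 fun δ hδ hlt => ?_
  have h1 := (Finset.mem_piAntidiag.1 hδ).1
  rw [Finset.sum_eq_zero fun l _ => Nat.lt_one_iff.1 (hlt l)] at h1
  exact zero_ne_one h1

end PiAntidiag
-- Left-most derivations and their unique factorisation
namespace StochasticCFG

section Derivations

variable {T : Type*} (G : StochasticCFG T)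

/-- The complete left-most derivations that start at the string `s`. -/
def completions (s : List (Symbol T G.NT)) : Set (List (ContextFreeRule T G.NT)) :=
  {π | ∃ u : List T, G.Derives s π (u.map Symbol.terminal)}

variable {G}

/-- The terminal prefix ends exactly where the first nonterminal stands. Hence a rule has at most
one left-most application to a given string. -/
theorem leftmost_unique {u u' : List T} {A B : G.NT} {δ δ' : List (Symbol T G.NT)}
    (h : u.map Symbol.terminal ++ [Symbol.nonterminal A] ++ δ =
      u'.map Symbol.terminal ++ [Symbol.nonterminal B] ++ δ') :
    u = u' ∧ A = B ∧ δ = δ' := by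
  induction u generalizing u' with
  | nil => cases u' <;> simp_all
  | cons t u ih =>
    cases u' with
    | nil => simp at h
    | cons t' u' =>
      simp only [List.map_cons, List.cons_append, List.cons.injEq, Symbol.terminal.injEq] at h
      obtain ⟨h1, h2, h3⟩ := ih h.2
      exact ⟨by rw [h.1, h1], h2, h3⟩

theorem terminal_ne_leftmost {u u' : List T} {A : G.NT} {δ : List (Symbol T G.NT)} :
    (u.map Symbol.terminal : List (Symbol T G.NT)) ≠
      u'.map Symbol.terminal ++ [Symbol.nonterminal A] ++ δ := by
  intro h
  have : Symbol.nonterminal A ∈ (u.map Symbol.terminal : List (Symbol T G.NT)) := by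
    rw [h]; simp
  simp at this

theorem terminal_or_leftmost (s : List (Symbol T G.NT)) :
    (∃ u : List T, s = u.map Symbol.terminal) ∨
      ∃ (u : List T) (A : G.NT) (δ : List (Symbol T G.NT)),
        s = u.map Symbol.terminal ++ [Symbol.nonterminal A] ++ δ := by
  induction s with
  | nil => exact Or.inl ⟨[], rfl⟩
  | cons x s ih =>
    cases x with
    | nonterminal A => exact Or.inr ⟨[], A, s, rfl⟩
    | terminal t =>
      rcases ih with ⟨u, rfl⟩ | ⟨u, A, δ, rfl⟩
      · exact Or.inl ⟨t :: u, rfl⟩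
      · exact Or.inr ⟨t :: u, A, δ, rfl⟩

theorem LeftmostStep.unique {a b b' : List (Symbol T G.NT)} {r : ContextFreeRule T G.NT}
    (h : G.LeftmostStep a r b) (h' : G.LeftmostStep a r b') : b = b' := by
  obtain ⟨_, u, δ, rfl, rfl⟩ := h
  obtain ⟨_, u', δ', h1, rfl⟩ := h'
  obtain ⟨rfl, _, rfl⟩ := leftmost_unique h1
  rfl

theorem Derives.trans {a b c : List (Symbol T G.NT)} {π ψ : List (ContextFreeRule T G.NT)}
    (h : G.Derives a π b) (h' : G.Derives b ψ c) : G.Derives a (π ++ ψ) c := by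
  induction h with
  | nil => exact h'
  | cons hs _ ih => exact Derives.cons hs (ih h')

/-- Left-most steps are deterministic once the rule is given, so both derivations pass through the
same strings while `π` is applied. -/
theorem Derives.of_append {a b c : List (Symbol T G.NT)} {π ψ : List (ContextFreeRule T G.NT)}
    (h : G.Derives a π b) (h' : G.Derives a (π ++ ψ) c) : G.Derives b ψ c := by
  induction h with
  | nil => exact h'
  | cons hs _ ih =>
    cases h' with
    | cons hs' hd' =>
      obtain rfl := hs.unique hs'
      exact ih hd'

theorem Derives.terminal_left {u : List T} {π : List (ContextFreeRule T G.NT)}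
    {b : List (Symbol T G.NT)} (h : G.Derives (u.map Symbol.terminal) π b) : π = [] := by
  cases h with
  | nil => rfl
  | cons hs _ =>
    obtain ⟨_, u', δ, h1, _⟩ := hs
    exact absurd h1 terminal_ne_leftmost

theorem Derives.append_right {a b : List (Symbol T G.NT)} {π : List (ContextFreeRule T G.NT)}
    (h : G.Derives a π b) (d : List (Symbol T G.NT)) : G.Derives (a ++ d) π (b ++ d) := by
  induction h with
  | nil => exact Derives.nil _
  | cons hs _ ih =>
    refine Derives.cons ?_ ih
    obtain ⟨hr, u, δ, rfl, rfl⟩ := hs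
    exact ⟨hr, u, δ ++ d, by simp, by simp⟩

theorem Derives.terminal_cons {a b : List (Symbol T G.NT)} {π : List (ContextFreeRule T G.NT)}
    (h : G.Derives a π b) (t : T) :
    G.Derives (Symbol.terminal t :: a) π (Symbol.terminal t :: b) := by
  induction h with
  | nil => exact Derives.nil _
  | cons hs _ ih =>
    refine Derives.cons ?_ ih
    obtain ⟨hr, u, δ, rfl, rfl⟩ := hs
    exact ⟨hr, t :: u, δ, by simp, by simp⟩

theorem Derives.of_terminal_cons {a c : List (Symbol T G.NT)}
    {π : List (ContextFreeRule T G.NT)} {t : T}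
    (h : G.Derives (Symbol.terminal t :: a) π c) :
    ∃ b, c = Symbol.terminal t :: b ∧ G.Derives a π b := by
  generalize hs : Symbol.terminal t :: a = s at h
  induction h generalizing a with
  | nil => exact ⟨a, hs.symm, Derives.nil _⟩
  | cons hstep _ ih =>
    obtain ⟨hr, u, δ, rfl, rfl⟩ := hstep
    cases u with
    | nil => simp at hs
    | cons t' u =>
      simp only [List.map_cons, List.cons_append, List.cons.injEq, Symbol.terminal.injEq] at hs
      obtain ⟨rfl, rfl⟩ := hs
      obtain ⟨b, rfl, hb⟩ := ih (a := u.map Symbol.terminal ++ _ ++ δ) rfl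
      exact ⟨b, rfl, Derives.cons ⟨hr, u, δ, by simp, rfl⟩ hb⟩

theorem completions_terminal_cons (t : T) (s : List (Symbol T G.NT)) :
    G.completions (Symbol.terminal t :: s) = G.completions s := by
  ext π
  constructor
  · rintro ⟨u, hu⟩
    obtain ⟨b, hb, h⟩ := hu.of_terminal_cons
    cases u with
    | nil => simp at hb
    | cons t' u =>
      simp only [List.map_cons, List.cons.injEq] at hb
      exact ⟨u, hb.2 ▸ h⟩
  · rintro ⟨u, hu⟩
    exact ⟨t :: u, hu.terminal_cons t⟩

theorem completions_terminal_append (u : List T) (s : List (Symbol T G.NT)) :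
    G.completions (u.map Symbol.terminal ++ s) = G.completions s := by
  induction u with
  | nil => rfl
  | cons t u ih =>
    rw [List.map_cons, List.cons_append, completions_terminal_cons, ih]

theorem completions_terminal (u : List T) :
    G.completions (u.map Symbol.terminal) = {[]} := by
  ext π
  exact ⟨fun ⟨_, h⟩ => h.terminal_left, fun h => ⟨u, h ▸ Derives.nil _⟩⟩

theorem append_mem_completions {a d : List (Symbol T G.NT)}
    {π ψ : List (ContextFreeRule T G.NT)} (hπ : π ∈ G.completions a)
    (hψ : ψ ∈ G.completions d) : π ++ ψ ∈ G.completions (a ++ d) := by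
  obtain ⟨u, hu⟩ := hπ
  rw [← completions_terminal_append u] at hψ
  obtain ⟨v, hv⟩ := hψ
  exact ⟨v, (hu.append_right d).trans hv⟩

/-- As long as the left block contains a nonterminal, every step acts inside it; when it has become
terminal, the remaining rules complete `d`. -/
theorem exists_append_of_mem_completions {a d : List (Symbol T G.NT)}
    {π : List (ContextFreeRule T G.NT)} (hπ : π ∈ G.completions (a ++ d)) :
    ∃ π₁ ∈ G.completions a, ∃ π₂ ∈ G.completions d, π₁ ++ π₂ = π := by
  induction π generalizing a with
  | nil =>
    rcases terminal_or_leftmost a with ⟨u, rfl⟩ | ⟨u, A, δ, rfl⟩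
    · rw [completions_terminal_append] at hπ
      exact ⟨[], by simp [completions_terminal], [], hπ, rfl⟩
    · obtain ⟨v, hv⟩ := hπ
      generalize hs : u.map Symbol.terminal ++ [Symbol.nonterminal A] ++ δ ++ d = s at hv
      generalize hs' : (v.map Symbol.terminal : List (Symbol T G.NT)) = s' at hv
      cases hv
      subst hs
      rw [List.append_assoc] at hs'
      exact absurd hs' terminal_ne_leftmost
  | cons r π ih =>
    rcases terminal_or_leftmost a with ⟨u, rfl⟩ | ⟨u, A, δ, rfl⟩
    · rw [completions_terminal_append] at hπ
      exact ⟨[], by simp [completions_terminal], r :: π, hπ, rfl⟩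
    · obtain ⟨v, hv⟩ := hπ
      cases hv with
      | cons hs hd =>
        obtain ⟨hr, u', δ', h1, rfl⟩ := hs
        rw [List.append_assoc] at h1
        obtain ⟨rfl, rfl, rfl⟩ := leftmost_unique h1
        rw [← List.append_assoc] at hd
        obtain ⟨π₁, ⟨w, hw⟩, π₂, h₂, rfl⟩ := ih ⟨v, hd⟩
        exact ⟨r :: π₁, ⟨w, Derives.cons ⟨hr, u, δ, rfl, rfl⟩ hw⟩, π₂, h₂, rfl⟩

/-- After `π` only terminals are left, so no further rule applies. -/
theorem completions_prefix_free {a : List (Symbol T G.NT)}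
    {π ψ : List (ContextFreeRule T G.NT)} (h : π ∈ G.completions a)
    (h' : π ++ ψ ∈ G.completions a) : ψ = [] := by
  obtain ⟨u, hu⟩ := h
  obtain ⟨v, hv⟩ := h'
  exact (hu.of_append hv).terminal_left

/-- A complete derivation from a concatenation splits uniquely. -/
theorem bijective_append_completions (a d : List (Symbol T G.NT)) :
    Function.Bijective (fun q : G.completions a × G.completions d =>
      (⟨q.1.1 ++ q.2.1, append_mem_completions q.1.2 q.2.2⟩ : G.completions (a ++ d))) := by
  constructor
  · rintro ⟨⟨π₁, h₁⟩, ⟨π₂, h₂⟩⟩ ⟨⟨ψ₁, k₁⟩, ⟨ψ₂, k₂⟩⟩ h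
    simp only [Subtype.mk.injEq] at h
    have key : π₁ = ψ₁ ∧ π₂ = ψ₂ := by
      -- One of the two first factors is a prefix of the other; prefix-freeness makes them equal.
      rcases List.append_eq_append_iff.1 h with ⟨l, rfl, rfl⟩ | ⟨l, rfl, rfl⟩
      · simp [completions_prefix_free h₁ k₁]
      · simp [completions_prefix_free k₁ h₁]
    obtain ⟨rfl, rfl⟩ := key
    rfl
  · rintro ⟨π, hπ⟩
    obtain ⟨π₁, h₁, π₂, h₂, rfl⟩ := exists_append_of_mem_completions hπ
    exact ⟨⟨⟨π₁, h₁⟩, ⟨π₂, h₂⟩⟩, rfl⟩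

theorem Derives.mem_rules {a b : List (Symbol T G.NT)} {π : List (ContextFreeRule T G.NT)}
    (h : G.Derives a π b) : ∀ r ∈ π, r ∈ G.rules := by
  induction h with
  | nil => simp
  | cons hs _ ih =>
    intro r hr
    rcases List.mem_cons.1 hr with rfl | hr
    · exact hs.1
    · exact ih r hr

theorem mem_rules_of_mem_completions {s : List (Symbol T G.NT)}
    {π : List (ContextFreeRule T G.NT)} (h : π ∈ G.completions s) : ∀ r ∈ π, r ∈ G.rules :=
  h.choose_spec.mem_rules

theorem weight_cons (r : ContextFreeRule T G.NT) (π : List (ContextFreeRule T G.NT)) :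
    G.weight (r :: π) = G.p r * G.weight π := by
  simp [weight]

theorem weight_append (π ψ : List (ContextFreeRule T G.NT)) :
    G.weight (π ++ ψ) = G.weight π * G.weight ψ := by
  simp [weight]

theorem X_cons (Y : ContextFreeRule T G.NT → ℝ) (r : ContextFreeRule T G.NT)
    (π : List (ContextFreeRule T G.NT)) : G.X Y (r :: π) = Y r + G.X Y π := by
  simp [X]

theorem X_append (Y : ContextFreeRule T G.NT → ℝ) (π ψ : List (ContextFreeRule T G.NT)) :
    G.X Y (π ++ ψ) = G.X Y π + G.X Y ψ := by
  simp [X]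

theorem weight_nonneg {s : List (Symbol T G.NT)} {π : List (ContextFreeRule T G.NT)}
    (h : π ∈ G.completions s) : 0 ≤ G.weight π := by
  refine List.prod_nonneg fun x hx => ?_
  obtain ⟨r, hr, rfl⟩ := List.mem_map.1 hx
  exact G.p_nonneg r (mem_rules_of_mem_completions h r hr)

theorem abs_X_le {Y : ContextFreeRule T G.NT → ℝ} {C : ℝ} (hC : ∀ r ∈ G.rules, |Y r| ≤ C)
    {π : List (ContextFreeRule T G.NT)} (h : ∀ r ∈ π, r ∈ G.rules) :
    |G.X Y π| ≤ C * π.length := by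
  induction π with
  | nil => simp [X]
  | cons r π ih =>
    rw [X_cons, List.length_cons]
    push_cast
    have h1 := ih fun q hq => h q (List.mem_cons_of_mem _ hq)
    have h2 := hC r (h r List.mem_cons_self)
    have h3 := abs_add_le (Y r) (G.X Y π)
    linarith

variable (G) in
/-- The number of terminals in a string. -/
def terminals (s : List (Symbol T G.NT)) : ℕ :=
  s.countP fun s => match s with
    | Symbol.terminal _ => true
    | Symbol.nonterminal _ => false

theorem terminals_append (s s' : List (Symbol T G.NT)) :
    G.terminals (s ++ s') = G.terminals s + G.terminals s' :=
  List.countP_append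

theorem terminals_map_terminal (u : List T) :
    G.terminals (u.map Symbol.terminal) = u.length := by
  rw [terminals, List.countP_map, List.countP_eq_length]
  simp

/-- The number of terminals grows along a derivation by the number of terminals in its rules. -/
theorem Derives.terminals_eq {a b : List (Symbol T G.NT)}
    {π : List (ContextFreeRule T G.NT)} (h : G.Derives a π b) :
    G.terminals b = G.terminals a + (π.map G.terminalCount).sum := by
  induction h with
  | nil => simp
  | @cons _ _ _ r _ hs _ ih =>
    obtain ⟨_, u, δ, rfl, rfl⟩ := hs
    have h0 : G.terminals [Symbol.nonterminal r.input] = 0 := rfl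
    have h1 : G.terminalCount r = G.terminals r.output := rfl
    rw [ih]
    simp only [terminals_append, List.map_cons, List.sum_cons, h0, h1]
    omega

theorem X_eq_length_yield {Y : ContextFreeRule T G.NT → ℝ}
    (hY : ∀ r ∈ G.rules, Y r = (G.terminalCount r : ℝ)) {i : G.NT}
    {π : List (ContextFreeRule T G.NT)} {u : List T}
    (h : G.Derives [Symbol.nonterminal i] π (u.map Symbol.terminal)) :
    G.X Y π = (u.length : ℝ) := by
  have h1 := h.terminals_eq
  rw [terminals_map_terminal, show G.terminals [Symbol.nonterminal i] = 0 from rfl,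
    zero_add] at h1
  have h3 : π.map Y = π.map fun r => (G.terminalCount r : ℝ) :=
    List.map_congr_left fun r hr => hY r (h.mem_rules r hr)
  rw [X, h3, h1]
  simp [List.map_map, Function.comp_def]

theorem X_eq_length {Y : ContextFreeRule T G.NT → ℝ} (hY : ∀ r ∈ G.rules, Y r = 1)
    {s : List (Symbol T G.NT)} {π : List (ContextFreeRule T G.NT)} (h : π ∈ G.completions s) :
    G.X Y π = (π.length : ℝ) := by
  have h3 : π.map Y = π.map fun _ => (1 : ℝ) :=
    List.map_congr_left fun r hr => hY r (mem_rules_of_mem_completions h r hr)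
  rw [X, h3]
  simp

end Derivations

end StochasticCFG
-- Termination and second moments by truncation and drift
/-- Uniform bounds on the sums of truncations give summability. -/
theorem summable_and_tsum_le_of_truncations {ι : Type*} {f : ι → ℝ} (hf : ∀ x, 0 ≤ f x)
    (len : ι → ℕ) {c : ℝ}
    (h : ∀ N : ℕ, ∃ x ≤ c, HasSum (fun q => if len q ≤ N then f q else 0) x) :
    Summable f ∧ ∑' q, f q ≤ c := by
  have key : ∀ F : Finset ι, ∑ q ∈ F, f q ≤ c := by
    intro F
    -- At this truncation level every term indexed by `F` is kept.
    obtain ⟨x, hx, hs⟩ := h (F.sup len)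
    refine le_trans ?_ hx
    refine le_trans (le_of_eq (Finset.sum_congr rfl fun q hq => ?_)) (sum_le_hasSum F ?_ hs)
    · rw [if_pos (Finset.le_sup hq)]
    · intro q _
      split_ifs
      exacts [hf q, le_rfl]
  have hsum := summable_of_sum_le hf key
  exact ⟨hsum, hsum.tsum_le_of_sum_le key⟩

theorem HasSum.of_eq {ι : Type*} {f g : ι → ℝ} {a b : ℝ} (h : HasSum f a) (hfg : ∀ q, g q = f q)
    (hab : b = a) : HasSum g b := by
  rwa [hab, show g = f from funext hfg]

theorem HasSum.mul_prod_real {ι κ : Type*} {f : ι → ℝ} {g : κ → ℝ} {a b : ℝ} (hf : HasSum f a)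
    (hg : HasSum g b) : HasSum (fun q : ι × κ => f q.1 * g q.2) (a * b) :=
  hf.mul hg (summable_mul_of_summable_norm hf.summable.norm hg.summable.norm)

namespace StochasticCFG

section Moments

variable {T : Type*} (G : StochasticCFG T)

/-- The additive extension of `f` from nonterminals to strings. -/
def additive (f : G.NT → ℝ) (s : List (Symbol T G.NT)) : ℝ :=
  (s.map fun x => match x with
    | Symbol.terminal _ => 0
    | Symbol.nonterminal A => f A).sum

variable {G}

theorem additive_append (f : G.NT → ℝ) (s s' : List (Symbol T G.NT)) :
    G.additive f (s ++ s') = G.additive f s + G.additive f s' := by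
  simp [additive]

theorem additive_nil (f : G.NT → ℝ) : G.additive f [] = 0 := rfl

theorem additive_terminal_cons (f : G.NT → ℝ) (t : T) (s : List (Symbol T G.NT)) :
    G.additive f (Symbol.terminal t :: s) = G.additive f s := by
  simp [additive]

theorem additive_nonterminal_cons (f : G.NT → ℝ) (A : G.NT) (s : List (Symbol T G.NT)) :
    G.additive f (Symbol.nonterminal A :: s) = f A + G.additive f s := by
  simp [additive]

theorem additive_terminal (f : G.NT → ℝ) (u : List T) :
    G.additive f (u.map Symbol.terminal) = 0 := by
  induction u with
  | nil => rfl
  | cons t u ih => rw [List.map_cons, additive_terminal_cons, ih]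

theorem additive_leftmost (f : G.NT → ℝ) (u : List T) (A : G.NT) (δ : List (Symbol T G.NT)) :
    G.additive f (u.map Symbol.terminal ++ [Symbol.nonterminal A] ++ δ) =
      f A + G.additive f δ := by
  rw [additive_append, additive_append, additive_terminal, additive_nonterminal_cons,
    additive_nil]
  ring

theorem additive_nonneg {f : G.NT → ℝ} (hf : ∀ A, 0 ≤ f A) (s : List (Symbol T G.NT)) :
    0 ≤ G.additive f s := by
  refine List.sum_nonneg fun x hx => ?_
  obtain ⟨y, _, rfl⟩ := List.mem_map.1 hx
  cases y
  exacts [le_rfl, hf _]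

theorem hasSum_completions_terminal (u : List T) (f : List (ContextFreeRule T G.NT) → ℝ) {x : ℝ}
    (hx : f [] = x) : HasSum (fun π : G.completions (u.map Symbol.terminal) => f π) x := by
  subst hx
  rw [completions_terminal]
  exact hasSum_unique (fun π : ({[]} : Set (List (ContextFreeRule T G.NT))) => f π)

theorem hasSum_completions_append {s d : List (Symbol T G.NT)}
    (f : List (ContextFreeRule T G.NT) → ℝ) {a : ℝ}
    (h : HasSum (fun q : G.completions s × G.completions d => f (q.1.1 ++ q.2.1)) a) :
    HasSum (fun π : G.completions (s ++ d) => f π) a :=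
  (Equiv.hasSum_iff (Equiv.ofBijective _ (bijective_append_completions s d))).1 h

theorem hasSum_truncation_zero {u : List T} {A : G.NT} {δ : List (Symbol T G.NT)}
    (f : List (ContextFreeRule T G.NT) → ℝ) :
    HasSum (fun π : G.completions (u.map Symbol.terminal ++ [Symbol.nonterminal A] ++ δ) =>
      if π.1.length ≤ 0 then f π else 0) 0 := by
  convert hasSum_zero using 2 with π
  rw [if_neg]
  intro h
  obtain ⟨v, hv⟩ := π.2
  rw [List.eq_nil_of_length_eq_zero (Nat.le_zero.1 h)] at hv
  generalize hs : u.map Symbol.terminal ++ [Symbol.nonterminal A] ++ δ = s at hv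
  generalize hs' : (v.map Symbol.terminal : List (Symbol T G.NT)) = s' at hv
  cases hv
  rw [← hs'] at hs
  exact terminal_ne_leftmost hs.symm

section Rules

variable [DecidableEq G.NT]

theorem additive_output [DecidableEq T] [Fintype G.NT] (f : G.NT → ℝ)
    (r : ContextFreeRule T G.NT) :
    G.additive f r.output = ∑ n, (G.ntCount n r : ℝ) * f n := by
  unfold ntCount
  generalize r.output = s
  induction s with
  | nil => simp [additive]
  | cons x s ih =>
    cases x with
    | terminal t =>
      rw [additive_terminal_cons, ih]
      refine Finset.sum_congr rfl fun n _ => ?_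
      rw [List.count_cons_of_ne (by simp)]
    | nonterminal A =>
      rw [additive_nonterminal_cons, ih]
      have h : ∀ n, ((List.count (Symbol.nonterminal n) (Symbol.nonterminal A :: s) : ℕ) : ℝ) =
          (List.count (Symbol.nonterminal n) s : ℝ) + if n = A then 1 else 0 := by
        intro n
        rw [List.count_cons]
        by_cases h : n = A
        · simp [h]
        · simp [h, Ne.symm h]
      simp_rw [h, add_mul, Finset.sum_add_distrib]
      simp [add_comm]

theorem mem_rulesOf {i : G.NT} {r : ContextFreeRule T G.NT} :
    r ∈ G.rulesOf i ↔ r ∈ G.rules ∧ r.input = i :=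
  Finset.mem_filter

theorem completions_leftmost (u : List T) (A : G.NT) (δ : List (Symbol T G.NT)) :
    G.completions (u.map Symbol.terminal ++ [Symbol.nonterminal A] ++ δ) =
      ⋃ r ∈ G.rulesOf A,
        List.cons r '' G.completions (u.map Symbol.terminal ++ r.output ++ δ) := by
  ext π
  simp only [Set.mem_iUnion, Set.mem_image, exists_prop]
  constructor
  · rintro ⟨v, hv⟩
    generalize hs : u.map Symbol.terminal ++ [Symbol.nonterminal A] ++ δ = s at hv
    generalize hs' : (v.map Symbol.terminal : List (Symbol T G.NT)) = s' at hv
    cases hv with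
    | nil =>
      rw [← hs'] at hs
      exact absurd hs.symm terminal_ne_leftmost
    | @cons _ _ _ r π hstep hd =>
      obtain ⟨hr, u', δ', rfl, rfl⟩ := hstep
      obtain ⟨rfl, rfl, rfl⟩ := leftmost_unique hs
      exact ⟨r, mem_rulesOf.2 ⟨hr, rfl⟩, π, ⟨v, hs' ▸ hd⟩, rfl⟩
  · rintro ⟨r, hr, π, ⟨v, hv⟩, rfl⟩
    obtain ⟨hmem, rfl⟩ := mem_rulesOf.1 hr
    exact ⟨v, Derives.cons ⟨hmem, u, δ, rfl, rfl⟩ hv⟩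

/-- First-step decomposition of a sum over complete derivations. -/
theorem hasSum_completions_leftmost (u : List T) (A : G.NT) (δ : List (Symbol T G.NT))
    {f : List (ContextFreeRule T G.NT) → ℝ} {a : ContextFreeRule T G.NT → ℝ}
    (h : ∀ r ∈ G.rulesOf A, HasSum
      (fun π : G.completions (u.map Symbol.terminal ++ r.output ++ δ) => f (r :: π)) (a r)) :
    HasSum (fun π : G.completions (u.map Symbol.terminal ++ [Symbol.nonterminal A] ++ δ) =>
      f π) (∑ r ∈ G.rulesOf A, a r) := by
  rw [completions_leftmost]
  refine hasSum_sum_disjoint (f := f) (t := fun r => List.cons r ''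
      G.completions (u.map Symbol.terminal ++ r.output ++ δ)) (G.rulesOf A) ?_ ?_
  · intro r _ r' _ hne
    refine Set.disjoint_left.2 ?_
    rintro _ ⟨π, _, rfl⟩ ⟨ψ, _, hψ⟩
    exact hne (List.cons.inj hψ).1.symm
  · intro r hr
    refine (Equiv.hasSum_iff (Equiv.Set.image (List.cons r) _
      (List.cons_injective))).1 ?_
    exact h r hr

/-- The first rule uses up one unit of the length bound. Letting `g` differ from `f` allows a step
counter to be updated along the way. -/
theorem hasSum_truncation_succ {u : List T} {A : G.NT} {δ : List (Symbol T G.NT)} {N : ℕ}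
    {f : List (ContextFreeRule T G.NT) → ℝ} {g : ContextFreeRule T G.NT →
      List (ContextFreeRule T G.NT) → ℝ} {a : ContextFreeRule T G.NT → ℝ}
    (hfg : ∀ r π, f (r :: π) = G.p r * g r π)
    (h : ∀ r ∈ G.rulesOf A, HasSum
      (fun π : G.completions (u.map Symbol.terminal ++ r.output ++ δ) =>
        if π.1.length ≤ N then g r π else 0) (a r)) :
    HasSum (fun π : G.completions (u.map Symbol.terminal ++ [Symbol.nonterminal A] ++ δ) =>
      if π.1.length ≤ N + 1 then f π else 0) (∑ r ∈ G.rulesOf A, G.p r * a r) := by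
  refine hasSum_completions_leftmost (f := fun π => if π.length ≤ N + 1 then f π else 0) u A δ
    fun r hr => ?_
  have h1 := (h r hr).mul_left (G.p r)
  simpa only [List.length_cons, Nat.add_le_add_iff_right, hfg, mul_ite, mul_zero] using h1

theorem p_nonneg_of_mem {i : G.NT} {r : ContextFreeRule T G.NT} (hr : r ∈ G.rulesOf i) :
    0 ≤ G.p r :=
  G.p_nonneg r (mem_rulesOf.1 hr).1

theorem hasSum_completions_nonterminal (A : G.NT)
    (f : List (ContextFreeRule T G.NT) → ℝ) {a : ContextFreeRule T G.NT → ℝ}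
    (h : ∀ r ∈ G.rulesOf A, HasSum (fun π : G.completions r.output => f (r :: π)) (a r)) :
    HasSum (fun π : G.completions [Symbol.nonterminal A] => f π) (∑ r ∈ G.rulesOf A, a r) := by
  refine hasSum_completions_leftmost [] A [] (f := f) fun r hr => ?_
  rw [List.map_nil, List.nil_append, List.append_nil]
  exact h r hr

/-- If `h` decreases by one in expectation at each step, then a derivation terminates within `N`
steps with probability at least `1 - h / (N + 1)`. -/
theorem exists_hasSum_truncated_weight (hproper : G.IsProper) {h : G.NT → ℝ}
    (h0 : ∀ i, 0 ≤ h i)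
    (hh : ∀ i, ∑ r ∈ G.rulesOf i, G.p r * G.additive h r.output = h i - 1)
    (N : ℕ) (s : List (Symbol T G.NT)) :
    ∃ x ≤ 1, 1 - G.additive h s / (N + 1) ≤ x ∧
      HasSum (fun π : G.completions s => if π.1.length ≤ N then G.weight π else 0) x := by
  -- Needed for the case `N = 0`: a string with a nonterminal has mass 0 there, and the lower bound
  -- must not exceed it.
  have hge : ∀ i, 1 ≤ h i := fun i => by
    have : 0 ≤ ∑ r ∈ G.rulesOf i, G.p r * G.additive h r.output :=
      Finset.sum_nonneg fun r hr => mul_nonneg (p_nonneg_of_mem hr) (additive_nonneg h0 _)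
    linarith [hh i]
  induction N generalizing s with
  | zero =>
    rcases terminal_or_leftmost s with ⟨u, rfl⟩ | ⟨u, A, δ, rfl⟩
    · refine ⟨1, le_rfl, by rw [additive_terminal]; simp, ?_⟩
      exact hasSum_completions_terminal u
        (fun π => if π.length ≤ 0 then G.weight π else 0) (by simp [weight])
    · refine ⟨0, zero_le_one, ?_, hasSum_truncation_zero _⟩
      rw [additive_leftmost]
      have := additive_nonneg h0 δ
      have := hge A
      norm_num
      linarith
  | succ N ih =>
    rcases terminal_or_leftmost s with ⟨u, rfl⟩ | ⟨u, A, δ, rfl⟩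
    · refine ⟨1, le_rfl, by rw [additive_terminal]; simp, ?_⟩
      exact hasSum_completions_terminal u
        (fun π => if π.length ≤ N + 1 then G.weight π else 0) (by simp [weight])
    · choose a ha1 ha2 ha3 using fun r : ContextFreeRule T G.NT =>
        ih (u.map Symbol.terminal ++ r.output ++ δ)
      have hs := hasSum_truncation_succ (g := fun _ π => G.weight π)
        weight_cons fun r (_ : r ∈ G.rulesOf A) => ha3 r
      have hnn : 0 ≤ ∑ r ∈ G.rulesOf A, G.p r * a r := by
        refine hs.nonneg fun π => ?_
        split_ifs
        exacts [weight_nonneg π.2, le_rfl]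
      refine ⟨_, ?_, ?_, hs⟩
      · rw [← hproper A]
        exact Finset.sum_le_sum fun r hr => mul_le_of_le_one_right (p_nonneg_of_mem hr) (ha1 r)
      · rw [additive_leftmost]
        set H := h A + G.additive h δ with hH
        have h1 : 1 - (H - 1) / (N + 1) ≤ ∑ r ∈ G.rulesOf A, G.p r * a r := by
          calc 1 - (H - 1) / (N + 1)
              = ∑ r ∈ G.rulesOf A, G.p r *
                (1 - (G.additive h r.output + G.additive h δ) / (N + 1)) := by
                simp_rw [mul_sub, mul_one, Finset.sum_sub_distrib, hproper A, ← mul_div_assoc,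
                  mul_add, ← Finset.sum_div, Finset.sum_add_distrib, ← Finset.sum_mul, hproper A,
                  hh A, hH]
                ring
            _ ≤ _ := by
                refine Finset.sum_le_sum fun r hr =>
                  mul_le_mul_of_nonneg_left ?_ (p_nonneg_of_mem hr)
                have := ha2 r
                rwa [additive_append, additive_append, additive_terminal, zero_add] at this
        push_cast
        -- The drift bound (H - 1)/(N + 1) is at most H/(N + 2) exactly when H ≤ N + 2; beyond that
        -- the claimed lower bound is negative.
        by_cases hc : H ≤ N + 1 + 1
        · refine le_trans ?_ h1
          have hN : (0 : ℝ) ≤ N := Nat.cast_nonneg N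
          have : (H - 1) / (N + 1) ≤ H / (N + 1 + 1) := by
            rw [div_le_div_iff₀ (by positivity) (by positivity)]
            nlinarith
          linarith
        · refine le_trans ?_ hnn
          have hN : (0 : ℝ) ≤ N := Nat.cast_nonneg N
          have : 1 ≤ H / (N + 1 + 1) := by
            rw [le_div_iff₀ (by positivity)]
            linarith
          linarith

/-- Complete derivations have total probability one. -/
theorem hasSum_weight (hproper : G.IsProper) {h : G.NT → ℝ} (h0 : ∀ i, 0 ≤ h i)
    (hh : ∀ i, ∑ r ∈ G.rulesOf i, G.p r * G.additive h r.output = h i - 1)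
    (s : List (Symbol T G.NT)) : HasSum (fun π : G.completions s => G.weight π) 1 := by
  have key := fun N => exists_hasSum_truncated_weight hproper h0 hh N s
  obtain ⟨hsum, hle⟩ := summable_and_tsum_le_of_truncations
    (f := fun π : G.completions s => G.weight π) (fun π => weight_nonneg π.2)
    (fun π => π.1.length) (c := 1) fun N => by
      obtain ⟨x, hx, _, hs⟩ := key N
      exact ⟨x, hx, hs⟩
  have hge : ∀ N : ℕ, 1 - G.additive h s / ((N : ℝ) + 1) ≤ ∑' π : G.completions s, G.weight π := by
    intro N
    obtain ⟨x, _, hx, hs⟩ := key N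
    refine hx.trans (hasSum_le (fun π => ?_) hs hsum.hasSum)
    split_ifs
    exacts [le_rfl, weight_nonneg π.2]
  have hlim : Filter.Tendsto (fun N : ℕ => 1 - G.additive h s / ((N : ℝ) + 1)) Filter.atTop
      (nhds (1 - 0)) := by
    refine tendsto_const_nhds.sub ?_
    have := (tendsto_one_div_add_atTop_nhds_zero_nat (𝕜 := ℝ)).const_mul (G.additive h s)
    simpa [div_eq_mul_inv] using this
  rw [sub_zero] at hlim
  have h1 : ∑' π : G.completions s, G.weight π = 1 := le_antisymm hle (le_of_tendsto' hlim hge)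
  rw [← h1]
  exact hsum.hasSum

/-- The quadratic Lyapunov bound for the second moment of the number of steps. -/
theorem exists_hasSum_truncated_sq (hproper : G.IsProper) {h : G.NT → ℝ}
    (h0 : ∀ i, 0 ≤ h i)
    (hh : ∀ i, ∑ r ∈ G.rulesOf i, G.p r * G.additive h r.output = h i - 1) {B : ℝ} (hB : 0 ≤ B)
    (hvar : ∀ i, ∑ r ∈ G.rulesOf i, G.p r * (1 + G.additive h r.output - h i) ^ 2 ≤ B)
    (N : ℕ) (k : ℝ) (s : List (Symbol T G.NT)) :
    ∃ x ≤ (k + G.additive h s) ^ 2 + B * G.additive h s,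
      HasSum (fun π : G.completions s =>
        if π.1.length ≤ N then G.weight π * (k + π.1.length) ^ 2 else 0) x := by
  induction N generalizing s k with
  | zero =>
    rcases terminal_or_leftmost s with ⟨u, rfl⟩ | ⟨u, A, δ, rfl⟩
    · refine ⟨k ^ 2, by rw [additive_terminal]; simp, ?_⟩
      exact hasSum_completions_terminal u
        (fun π => if π.length ≤ 0 then G.weight π * (k + π.length) ^ 2 else 0) (by simp [weight])
    · refine ⟨0, ?_, hasSum_truncation_zero (fun π => G.weight π * (k + π.length) ^ 2)⟩
      have := additive_nonneg h0 (u.map Symbol.terminal ++ [Symbol.nonterminal A] ++ δ)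
      positivity
  | succ N ih =>
    rcases terminal_or_leftmost s with ⟨u, rfl⟩ | ⟨u, A, δ, rfl⟩
    · refine ⟨k ^ 2, by rw [additive_terminal]; simp, ?_⟩
      exact hasSum_completions_terminal u
        (fun π => if π.length ≤ N + 1 then G.weight π * (k + π.length) ^ 2 else 0) (by simp [weight])
    · choose a ha1 ha2 using fun r : ContextFreeRule T G.NT =>
        ih (k + 1) (u.map Symbol.terminal ++ r.output ++ δ)
      refine ⟨_, ?_, hasSum_truncation_succ
        (f := fun π => G.weight π * (k + π.length) ^ 2)
        (g := fun _ π => G.weight π * (k + 1 + π.length) ^ 2)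
        (fun r π => by rw [weight_cons, List.length_cons]; push_cast; ring)
        fun r (_ : r ∈ G.rulesOf A) => ha2 r⟩
      rw [additive_leftmost]
      set D := G.additive h δ with hD
      calc ∑ r ∈ G.rulesOf A, G.p r * a r
          ≤ ∑ r ∈ G.rulesOf A, G.p r * ((k + 1 + (G.additive h r.output + D)) ^ 2 +
            B * (G.additive h r.output + D)) := by
            refine Finset.sum_le_sum fun r hr =>
              mul_le_mul_of_nonneg_left ?_ (p_nonneg_of_mem hr)
            have := ha1 r
            rwa [additive_append, additive_append, additive_terminal, zero_add] at this
        -- Expansion around k + h A + D. The increment 1 + h(output) - h A has mean zero, so only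
        -- its variance, at most `B`, survives; the mean decrease of the term B h pays for it.
        _ = ∑ r ∈ G.rulesOf A, (G.p r * (1 + G.additive h r.output - h A) ^ 2
              + (2 * (k + h A + D) + B) * (G.p r * G.additive h r.output)
              + ((k + h A + D) ^ 2 + 2 * (k + h A + D) * (1 - h A) + B * D) * G.p r) :=
            Finset.sum_congr rfl fun r _ => by ring
        _ = ∑ r ∈ G.rulesOf A, G.p r * (1 + G.additive h r.output - h A) ^ 2
              + (2 * (k + h A + D) + B) * (h A - 1)
              + ((k + h A + D) ^ 2 + 2 * (k + h A + D) * (1 - h A) + B * D) := by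
            rw [Finset.sum_add_distrib, Finset.sum_add_distrib, ← Finset.mul_sum,
              ← Finset.mul_sum, hh A, hproper A, mul_one]
        _ ≤ _ := by linarith [hvar A]

/-- The number of steps has a second moment. -/
theorem summable_weight_mul_sq (hproper : G.IsProper) {h : G.NT → ℝ}
    (h0 : ∀ i, 0 ≤ h i)
    (hh : ∀ i, ∑ r ∈ G.rulesOf i, G.p r * G.additive h r.output = h i - 1)
    (s : List (Symbol T G.NT)) :
    Summable fun π : G.completions s => G.weight π * (1 + π.1.length) ^ 2 := by
  -- Summing over all rules gives one variance bound valid for every nonterminal.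
  have hvar : ∀ i, ∑ r ∈ G.rulesOf i, G.p r * (1 + G.additive h r.output - h i) ^ 2 ≤
      ∑ r ∈ G.rules, G.p r * (1 + G.additive h r.output - h r.input) ^ 2 := by
    intro i
    calc ∑ r ∈ G.rulesOf i, G.p r * (1 + G.additive h r.output - h i) ^ 2
        = ∑ r ∈ G.rulesOf i, G.p r * (1 + G.additive h r.output - h r.input) ^ 2 :=
          Finset.sum_congr rfl fun r hr => by rw [(mem_rulesOf.1 hr).2]
      _ ≤ _ := Finset.sum_le_sum_of_subset_of_nonneg (Finset.filter_subset _ _)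
          fun r hr _ => mul_nonneg (G.p_nonneg r hr) (sq_nonneg _)
  have hB : 0 ≤ ∑ r ∈ G.rules, G.p r * (1 + G.additive h r.output - h r.input) ^ 2 :=
    Finset.sum_nonneg fun r hr => mul_nonneg (G.p_nonneg r hr) (sq_nonneg _)
  exact (summable_and_tsum_le_of_truncations
    (f := fun π : G.completions s => G.weight π * (1 + π.1.length) ^ 2)
    (c := (1 + G.additive h s) ^ 2 + (∑ r ∈ G.rules,
      G.p r * (1 + G.additive h r.output - h r.input) ^ 2) * G.additive h s)
    (fun π => mul_nonneg (weight_nonneg π.2) (sq_nonneg _)) (fun π => π.1.length)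
    fun N => exists_hasSum_truncated_sq hproper h0 hh hB hvar N 1 s).1

end Rules

/-- Domination by a multiple of the squared number of steps. -/
theorem summable_weight_mul {s : List (Symbol T G.NT)}
    (h : Summable fun π : G.completions s => G.weight π * (1 + π.1.length) ^ 2)
    {f : List (ContextFreeRule T G.NT) → ℝ} {C : ℝ}
    (hf : ∀ π ∈ G.completions s, |f π| ≤ C * (1 + π.length) ^ 2) :
    Summable fun π : G.completions s => G.weight π * f π := by
  refine Summable.of_norm_bounded (h.mul_left C) fun π => ?_
  rw [Real.norm_eq_abs, abs_mul, abs_of_nonneg (weight_nonneg π.2)]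
  calc G.weight π * |f π| ≤ G.weight π * (C * (1 + π.1.length) ^ 2) :=
        mul_le_mul_of_nonneg_left (hf π π.2) (weight_nonneg π.2)
    _ = _ := by ring

theorem summable_weight_mul_X {s : List (Symbol T G.NT)}
    (h : Summable fun π : G.completions s => G.weight π * (1 + π.1.length) ^ 2)
    (Y : ContextFreeRule T G.NT → ℝ) :
    (Summable fun π : G.completions s => G.weight π * G.X Y π) ∧
      Summable fun π : G.completions s => G.weight π * G.X Y π ^ 2 := by
  set C : ℝ := ∑ r ∈ G.rules, |Y r| with hC
  have hC0 : 0 ≤ C := Finset.sum_nonneg fun _ _ => abs_nonneg _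
  have hX : ∀ π ∈ G.completions s, |G.X Y π| ≤ C * π.length := fun π hπ =>
    abs_X_le (fun r hr => Finset.single_le_sum (f := fun r => |Y r|)
      (fun _ _ => abs_nonneg _) hr) (mem_rules_of_mem_completions hπ)
  constructor
  · refine summable_weight_mul h (f := G.X Y) (C := C) fun π hπ => (hX π hπ).trans ?_
    refine mul_le_mul_of_nonneg_left ?_ hC0
    nlinarith [Nat.cast_nonneg (α := ℝ) π.length]
  · refine summable_weight_mul h (f := fun π => G.X Y π ^ 2) (C := C ^ 2) fun π hπ => ?_
    rw [abs_pow, ← mul_pow]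
    refine pow_le_pow_left₀ (abs_nonneg _) ((hX π hπ).trans ?_) 2
    exact mul_le_mul_of_nonneg_left (by linarith) hC0

/-- The moments of a sum of independent contributions: means and variances are additive. -/
theorem hasSum_moments {Y : ContextFreeRule T G.NT → ℝ}
    (h0 : ∀ i, HasSum (fun π : G.completions [Symbol.nonterminal i] => G.weight π) 1)
    (h1 : ∀ i, HasSum (fun π : G.completions [Symbol.nonterminal i] => G.weight π * G.X Y π)
      (G.moment Y 1 i))
    (h2 : ∀ i, HasSum (fun π : G.completions [Symbol.nonterminal i] => G.weight π * G.X Y π ^ 2)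
      (G.moment Y 2 i))
    (s : List (Symbol T G.NT)) :
    HasSum (fun π : G.completions s => G.weight π) 1 ∧
    HasSum (fun π : G.completions s => G.weight π * G.X Y π)
      (G.additive (G.moment Y 1) s) ∧
    HasSum (fun π : G.completions s => G.weight π * G.X Y π ^ 2)
      (G.additive (G.moment Y 1) s ^ 2 +
        G.additive (fun i => G.moment Y 2 i - G.moment Y 1 i ^ 2) s) := by
  induction s with
  | nil =>
    refine ⟨?_, ?_, ?_⟩
    · exact hasSum_completions_terminal [] G.weight (by simp [weight])
    · exact hasSum_completions_terminal [] (fun π => G.weight π * G.X Y π)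
        (by simp [X, additive])
    · exact hasSum_completions_terminal [] (fun π => G.weight π * G.X Y π ^ 2)
        (by simp [X, additive])
  | cons x s ih =>
    obtain ⟨k0, k1, k2⟩ := ih
    cases x with
    | terminal t =>
      rw [completions_terminal_cons, additive_terminal_cons, additive_terminal_cons]
      exact ⟨k0, k1, k2⟩
    | nonterminal A =>
      rw [additive_nonterminal_cons, additive_nonterminal_cons]
      -- Each `eab` is the joint moment of order a in the contribution of `A` and b in that of `s`;
      -- the square of the sum uses those with a + b = 2.
      have e00 := (h0 A).mul_prod_real k0
      have e10 := (h1 A).mul_prod_real k0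
      have e01 := (h0 A).mul_prod_real k1
      have e20 := (h2 A).mul_prod_real k0
      have e11 := (h1 A).mul_prod_real k1
      have e02 := (h0 A).mul_prod_real k2
      refine ⟨hasSum_completions_append (s := [Symbol.nonterminal A]) G.weight ?_,
        hasSum_completions_append (s := [Symbol.nonterminal A])
          (fun π => G.weight π * G.X Y π) ?_,
        hasSum_completions_append (s := [Symbol.nonterminal A])
          (fun π => G.weight π * G.X Y π ^ 2) ?_⟩
      · simpa only [weight_append, mul_one] using e00
      · convert e10.add e01 using 1
        · ext q
          rw [weight_append, X_append]
          ring
        · ring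
      · convert (e20.add e02).add (e11.mul_left 2) using 1
        · ext q
          rw [weight_append, X_append]
          ring
        · ring

end Moments

end StochasticCFG
-- The linear systems for the first two moments
namespace StochasticCFG

section Moments

variable {T : Type*} {G : StochasticCFG T}

/-- For n < 2 all entries of δ are 0 or 1, where the moment of order δ is the δ-th power of the
mean; the multinomial theorem applies. -/
theorem sum_piAntidiag_moment {Y : ContextFreeRule T G.NT → ℝ}
    (h0 : ∀ i, G.moment Y 0 i = 1) (k : G.NT) (R : ℕ) {n : ℕ}
    (hn : n < 2) :
    ∑ δ ∈ Finset.piAntidiag (Finset.univ : Finset (Fin R)) n,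
      (Nat.multinomial Finset.univ δ : ℝ) * ∏ l, G.moment Y (δ l) k =
      ((R : ℝ) * G.moment Y 1 k) ^ n := by
  have h1 : (R : ℝ) * G.moment Y 1 k = ∑ _l : Fin R, G.moment Y 1 k := by simp
  rw [h1, Finset.sum_pow_eq_sum_piAntidiag]
  refine Finset.sum_congr rfl fun δ hδ => ?_
  rw [Finset.prod_apply_eq_prod_pow (m := fun n (_ : Fin R) => G.moment Y n k) (fun _ => h0 k)
    (Finset.lt_two_of_mem_piAntidiag_univ hδ hn)]

variable [DecidableEq T] [DecidableEq G.NT]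

theorem expMatrix_nonneg (i n : G.NT) : 0 ≤ G.expMatrix i n :=
  Finset.sum_nonneg fun _ hr => mul_nonneg (p_nonneg_of_mem hr) (Nat.cast_nonneg _)

variable [Fintype G.NT]

/-- The link between linear algebra and derivations: M acts as the one-step expectation of additive
functions. -/
theorem expMatrix_mulVec (f : G.NT → ℝ) (i : G.NT) :
    G.expMatrix.mulVec f i = ∑ r ∈ G.rulesOf i, G.p r * G.additive f r.output := by
  simp_rw [Matrix.mulVec, dotProduct, expMatrix, Matrix.of_apply, additive_output,
    Finset.sum_mul, Finset.mul_sum]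
  rw [Finset.sum_comm]
  exact Finset.sum_congr rfl fun r _ => Finset.sum_congr rfl fun n _ => by ring

theorem eq_inv_mulVec (hu : IsUnit (1 - G.expMatrix)) {m b : G.NT → ℝ}
    (h : ∀ i, m i = b i + G.expMatrix.mulVec m i) : m = (1 - G.expMatrix)⁻¹.mulVec b := by
  have h1 : (1 - G.expMatrix).mulVec m = b := by
    ext i
    rw [Matrix.sub_mulVec, Matrix.one_mulVec, Pi.sub_apply]
    linarith [h i]
  rw [← h1, Matrix.mulVec_mulVec,
    Matrix.nonsing_inv_mul _ ((Matrix.isUnit_iff_isUnit_det _).1 hu), Matrix.one_mulVec]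

/-- When `ρ(M) < 1`, some nonnegative function on nonterminals decreases by exactly one in
expectation at each step. -/
theorem exists_drift (hM : spectralRadius ℂ (G.expMatrix.map (fun x : ℝ => (x : ℂ))) < 1) :
    ∃ h : G.NT → ℝ, (∀ i, 0 ≤ h i) ∧
      ∀ i, ∑ r ∈ G.rulesOf i, G.p r * G.additive h r.output = h i - 1 := by
  obtain ⟨hu, hinv⟩ := Matrix.isUnit_one_sub_and_inv_nonneg _ hM expMatrix_nonneg
  -- The solution of h = 1 + M h, which turns out to be the expected derivation length.
  refine ⟨(1 - G.expMatrix)⁻¹.mulVec 1, fun i => ?_, fun i => ?_⟩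
  · exact Finset.sum_nonneg fun n _ => mul_nonneg (hinv i n) zero_le_one
  · have h1 : (1 - G.expMatrix).mulVec ((1 - G.expMatrix)⁻¹.mulVec 1) = 1 := by
      rw [Matrix.mulVec_mulVec,
        Matrix.mul_nonsing_inv _ ((Matrix.isUnit_iff_isUnit_det _).1 hu), Matrix.one_mulVec]
    have h2 := congrFun h1 i
    rw [Matrix.sub_mulVec, Matrix.one_mulVec, Pi.sub_apply, expMatrix_mulVec, Pi.one_apply] at h2
    linarith

section Coefficients

variable {Y : ContextFreeRule T G.NT → ℝ}

theorem H_eq (h0 : ∀ i, G.moment Y 0 i = 1) (r : ContextFreeRule T G.NT) {γ : G.NT → ℕ}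
    (hγ : ∀ k, γ k < 2) :
    G.H Y r γ = (Nat.multinomial Finset.univ γ : ℝ) *
      ∏ k, ((G.ntCount k r : ℝ) * G.moment Y 1 k) ^ γ k := by
  rw [H]
  congr 1
  exact Finset.prod_congr rfl fun k _ => sum_piAntidiag_moment h0 k _ (hγ k)

theorem Q_eq (h0 : ∀ i, G.moment Y 0 i = 1) (r : ContextFreeRule T G.NT) (α : ℕ) {β : ℕ}
    (hβ : β < 2) :
    G.Q Y r α β = (α.choose β : ℝ) * G.p r * Y r ^ (α - β) *
      (∑ n, (G.ntCount n r : ℝ) * G.moment Y 1 n) ^ β := by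
  rw [Q, Finset.sum_pow_eq_sum_piAntidiag]
  congr 1
  exact Finset.sum_congr rfl fun γ hγ =>
    H_eq h0 r (Finset.lt_two_of_mem_piAntidiag_univ hγ hβ)

/-- Entries below 1 cannot add up to 1, so both filtered sums are empty and only Q(1, 0) remains. -/
theorem c_one (h0 : ∀ i, G.moment Y 0 i = 1) (i : G.NT) :
    G.c Y 1 i = ∑ r ∈ G.rulesOf i, G.p r * Y r := by
  simp only [c, Finset.filter_piAntidiag_univ_one, Finset.sum_empty, Finset.sum_const_zero, mul_zero,
    zero_add, Finset.sum_range_one]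
  exact Finset.sum_congr rfl fun r _ => by rw [Q_eq h0 r 1 two_pos]; simp

theorem Q_two_zero (h0 : ∀ i, G.moment Y 0 i = 1) (r : ContextFreeRule T G.NT) :
    G.Q Y r 2 0 = G.p r * Y r ^ 2 := by
  rw [Q_eq h0 r 2 two_pos]; simp

theorem Q_two_one (h0 : ∀ i, G.moment Y 0 i = 1) (r : ContextFreeRule T G.NT) :
    G.Q Y r 2 1 = 2 * G.p r * Y r * ∑ n, (G.ntCount n r : ℝ) * G.moment Y 1 n := by
  rw [Q_eq h0 r 2 one_lt_two]; simp

theorem CR_eq (i : G.NT) : G.CR Y i = ∑ r ∈ G.rulesOf i, G.p r *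
    ((∑ n, (G.ntCount n r : ℝ) * G.moment Y 1 n) ^ 2 -
      ∑ n, (G.ntCount n r : ℝ) * G.moment Y 1 n ^ 2) := by
  simp_rw [CR, mul_sub, Finset.sum_sub_distrib, sq (∑ n, (G.ntCount n _ : ℝ) * G.moment Y 1 n),
    Finset.sum_mul_sum]
  congr 1
  exact Finset.sum_congr rfl fun r _ => congrArg _ <| Finset.sum_congr rfl fun a _ =>
    Finset.sum_congr rfl fun b _ => by ring

theorem c_two (h0 : ∀ i, G.moment Y 0 i = 1) (i : G.NT) :
    G.c Y 2 i =
      G.CR Y i + ∑ r ∈ G.rulesOf i, G.Q Y r 2 0 + ∑ r ∈ G.rulesOf i, G.Q Y r 2 1 := by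
  have h1 : ∀ (n : G.NT) (R : ℕ), ∑ δ ∈ (Finset.piAntidiag
      (Finset.univ : Finset (Fin R)) 2).filter (fun δ => ∀ l, δ l < 2),
      (Nat.multinomial Finset.univ δ : ℝ) * ∏ l, G.moment Y (δ l) n =
      ((R : ℝ) * G.moment Y 1 n) ^ 2 - R * G.moment Y 1 n ^ 2 := by
    intro n R
    have h2 := Finset.sum_piAntidiag_two_filter fun _ : Fin R => G.moment Y 1 n
    simp only [Finset.sum_const, Finset.card_univ, Fintype.card_fin, nsmul_eq_mul] at h2
    rw [← h2]
    refine Finset.sum_congr rfl fun δ hδ => ?_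
    rw [Finset.prod_apply_eq_prod_pow (m := fun n' (_ : Fin R) => G.moment Y n' n)
      (fun _ => h0 n) (Finset.mem_filter.1 hδ).2]
  have h3 : ∀ r, ∑ γ ∈ (Finset.piAntidiag (Finset.univ : Finset G.NT) 2).filter
      (fun γ => ∀ k, γ k < 2), G.H Y r γ =
      (∑ n, (G.ntCount n r : ℝ) * G.moment Y 1 n) ^ 2 -
        ∑ n, ((G.ntCount n r : ℝ) * G.moment Y 1 n) ^ 2 := by
    intro r
    rw [← Finset.sum_piAntidiag_two_filter]
    exact Finset.sum_congr rfl fun γ hγ => H_eq h0 r (Finset.mem_filter.1 hγ).2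
  rw [c, CR_eq]
  simp only [h1, h3, Finset.sum_range_succ, Finset.sum_range_zero, zero_add]
  rw [Finset.sum_add_distrib, ← add_assoc, ← Finset.sum_add_distrib]
  congr 2
  refine Finset.sum_congr rfl fun r _ => ?_
  -- The squares (r_n m_n)² missing from the γ-sum are supplied by the δ-sums, which leaves the two
  -- terms of `CR`.
  rw [Finset.sum_sub_distrib]
  ring

end Coefficients

/-- The recursions for the first two moments obtained by conditioning on the first rule. -/
theorem moment_recursions {Y : ContextFreeRule T G.NT → ℝ}
    (h0 : ∀ i, HasSum (fun π : G.completions [Symbol.nonterminal i] => G.weight π) 1)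
    (h1 : ∀ i, HasSum (fun π : G.completions [Symbol.nonterminal i] => G.weight π * G.X Y π)
      (G.moment Y 1 i))
    (h2 : ∀ i, HasSum (fun π : G.completions [Symbol.nonterminal i] => G.weight π * G.X Y π ^ 2)
      (G.moment Y 2 i)) (i : G.NT) :
    G.moment Y 1 i =
      ∑ r ∈ G.rulesOf i, G.p r * Y r + G.expMatrix.mulVec (G.moment Y 1) i ∧
    G.moment Y 2 i = (G.CR Y i + ∑ r ∈ G.rulesOf i, G.p r * Y r ^ 2 +
      ∑ r ∈ G.rulesOf i, 2 * G.p r * Y r * ∑ n, (G.ntCount n r : ℝ) * G.moment Y 1 n) +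
      G.expMatrix.mulVec (G.moment Y 2) i := by
  have key := hasSum_moments h0 h1 h2
  constructor
  · have e := hasSum_completions_nonterminal i (fun π => G.weight π * G.X Y π)
      (a := fun r => G.p r * Y r + G.p r * G.additive (G.moment Y 1) r.output) fun r _ => by
        obtain ⟨k0, k1, _⟩ := key r.output
        refine ((k0.mul_left (G.p r * Y r)).add (k1.mul_left (G.p r))).of_eq (fun π => ?_) ?_
        · rw [weight_cons, X_cons]
          ring
        · ring
    rw [expMatrix_mulVec, (h1 i).unique e, Finset.sum_add_distrib]
  · have e := hasSum_completions_nonterminal i (fun π => G.weight π * G.X Y π ^ 2)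
      (a := fun r => G.p r * Y r ^ 2 + 2 * G.p r * Y r * G.additive (G.moment Y 1) r.output +
        G.p r * (G.additive (G.moment Y 1) r.output ^ 2 +
          G.additive (fun i => G.moment Y 2 i - G.moment Y 1 i ^ 2) r.output)) fun r _ => by
        obtain ⟨k0, k1, k2⟩ := key r.output
        refine (((k0.mul_left (G.p r * Y r ^ 2)).add (k1.mul_left (2 * G.p r * Y r))).add
          (k2.mul_left (G.p r))).of_eq (fun π => ?_) ?_
        · rw [weight_cons, X_cons]
          ring
        · ring
    rw [expMatrix_mulVec, (h2 i).unique e, CR_eq, ← Finset.sum_add_distrib,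
      ← Finset.sum_add_distrib, ← Finset.sum_add_distrib]
    refine Finset.sum_congr rfl fun r _ => ?_
    -- Separating the variance into its two parts, the second moments give M m⁽²⁾, and the squared
    -- means complete `CR`.
    simp only [additive_output, mul_sub, Finset.sum_sub_distrib]
    ring

end Moments

end StochasticCFG

/-! ### The moment formulas -/

theorem mainTheorem2 {T : Type*} [DecidableEq T] (G : StochasticCFG T)
    [Fintype G.NT] [DecidableEq G.NT] (hred : G.IsReduced) (hproper : G.IsProper)
    (hM : spectralRadius ℂ (G.expMatrix.map (fun x : ℝ => (x : ℂ))) < 1)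
    (Y : ContextFreeRule T G.NT → ℝ) :
    -- consistency, existence of the moments, invertibility of `I - M`
    (∀ i, HasSum (fun π : G.Ω i => G.weight π) 1) ∧
    (∀ i, Summable fun π : G.Ω i => G.weight π * G.X Y π) ∧
    (∀ i, Summable fun π : G.Ω i => G.weight π * G.X Y π ^ 2) ∧
    IsUnit (1 - G.expMatrix) ∧
    -- first order
    (∀ i, G.c Y 1 i = ∑ r ∈ G.rulesOf i, G.p r * Y r) ∧
    G.moment Y 1 = (1 - G.expMatrix)⁻¹.mulVec (G.c Y 1) ∧
    -- second order
    (∀ i, G.c Y 2 i =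
      G.CR Y i + ∑ r ∈ G.rulesOf i, G.Q Y r 2 0 + ∑ r ∈ G.rulesOf i, G.Q Y r 2 1) ∧
    (∀ r ∈ G.rules, G.Q Y r 2 0 = G.p r * Y r ^ 2) ∧
    (∀ r ∈ G.rules, G.Q Y r 2 1 =
      2 * G.p r * Y r * ∑ n, (G.ntCount n r : ℝ) * G.moment Y 1 n) ∧
    G.moment Y 2 = (1 - G.expMatrix)⁻¹.mulVec (G.c Y 2) ∧
    -- derivation length
    ((∀ r ∈ G.rules, Y r = 1) →
      (∀ i, ∀ π ∈ G.Ω i, G.X Y π = (π.length : ℝ)) ∧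
      (∀ i, HasSum (fun π : G.Ω i => G.weight π * (π.1.length : ℝ))
        ((1 - G.expMatrix)⁻¹.mulVec 1 i)) ∧
      G.moment Y 1 = (1 - G.expMatrix)⁻¹.mulVec 1 ∧
      (∀ i, ∑ r ∈ G.rulesOf i, G.Q Y r 2 0 = 1) ∧
      (∀ i, ∑ r ∈ G.rulesOf i, G.Q Y r 2 1 = 2 * G.moment Y 1 i - 2) ∧
      (∀ i, G.c Y 2 i = G.CR Y i + 2 * G.moment Y 1 i - 1) ∧
      G.moment Y 2 =
        (1 - G.expMatrix)⁻¹.mulVec (fun i => G.CR Y i + 2 * G.moment Y 1 i - 1)) ∧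
    -- string length
    ((∀ r ∈ G.rules, Y r = (G.terminalCount r : ℝ)) →
      (∀ (i : G.NT) (π : List (ContextFreeRule T G.NT)) (u : List T),
        G.Derives [Symbol.nonterminal i] π (u.map Symbol.terminal) →
          G.X Y π = (u.length : ℝ)) ∧
      (∀ i, HasSum (fun π : G.Ω i => G.weight π * ((G.yield π).length : ℝ))
        (G.moment Y 1 i)) ∧
      G.moment Y 1 = (1 - G.expMatrix)⁻¹.mulVec
        (fun i => ∑ r ∈ G.rulesOf i, G.p r * (G.terminalCount r : ℝ))) := by
  classical
  obtain ⟨hu, -⟩ := Matrix.isUnit_one_sub_and_inv_nonneg _ hM StochasticCFG.expMatrix_nonneg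
  obtain ⟨h, hnn, hh⟩ := StochasticCFG.exists_drift hM
  -- `G.Ω i` is by definition `G.completions [Symbol.nonterminal i]`.
  have s0 : ∀ i, HasSum (fun π : G.Ω i => G.weight π) 1 := fun i =>
    StochasticCFG.hasSum_weight hproper hnn hh [Symbol.nonterminal i]
  have hX := fun i => StochasticCFG.summable_weight_mul_X
    (StochasticCFG.summable_weight_mul_sq hproper hnn hh [Symbol.nonterminal i]) Y
  have s1 : ∀ i, HasSum (fun π : G.Ω i => G.weight π * G.X Y π) (G.moment Y 1 i) := fun i => by
    have := (hX i).1.hasSum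
    simp_rw [StochasticCFG.moment, pow_one]
    exact this
  have s2 : ∀ i, HasSum (fun π : G.Ω i => G.weight π * G.X Y π ^ 2) (G.moment Y 2 i) := fun i =>
    (hX i).2.hasSum
  have m0 : ∀ i, G.moment Y 0 i = 1 := fun i => by
    simpa only [StochasticCFG.moment, pow_zero, mul_one] using (s0 i).tsum_eq
  have hrec := StochasticCFG.moment_recursions s0 s1 s2
  have c1 := StochasticCFG.c_one m0
  have c2 := StochasticCFG.c_two m0
  have q0 := StochasticCFG.Q_two_zero m0
  have q1 := StochasticCFG.Q_two_one m0
  have e1 : G.moment Y 1 = (1 - G.expMatrix)⁻¹.mulVec (G.c Y 1) :=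
    StochasticCFG.eq_inv_mulVec hu fun i => by rw [c1 i]; exact (hrec i).1
  have e2 : G.moment Y 2 = (1 - G.expMatrix)⁻¹.mulVec (G.c Y 2) :=
    StochasticCFG.eq_inv_mulVec hu fun i => by
      rw [c2 i]; simp only [q0, q1]; exact (hrec i).2
  refine ⟨s0, fun i => (hX i).1, fun i => (hX i).2, hu, c1, e1, c2, fun r _ => q0 r,
    fun r _ => q1 r, e2, fun hY => ?_, fun hY => ?_⟩
  · have hYi : ∀ i, ∀ r ∈ G.rulesOf i, Y r = 1 := fun i r hr =>
      hY r (StochasticCFG.mem_rulesOf.1 hr).1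
    have hlen : ∀ i, ∀ π ∈ G.Ω i, G.X Y π = (π.length : ℝ) := fun i π hπ =>
      StochasticCFG.X_eq_length hY hπ
    have hp : ∀ i, ∑ r ∈ G.rulesOf i, G.p r * Y r = 1 := fun i => by
      rw [← hproper i]
      exact Finset.sum_congr rfl fun r hr => by rw [hYi i r hr, mul_one]
    have e1' : G.moment Y 1 = (1 - G.expMatrix)⁻¹.mulVec 1 := by
      rw [e1]
      congr 1
      ext i
      rw [c1, hp, Pi.one_apply]
    have hq0 : ∀ i, ∑ r ∈ G.rulesOf i, G.Q Y r 2 0 = 1 := fun i => by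
      rw [← hproper i]
      exact Finset.sum_congr rfl fun r hr => by rw [q0, hYi i r hr, one_pow, mul_one]
    -- With Y = 1 the sum is 2 (M m⁽¹⁾)_i, and the first-order recursion reads M m⁽¹⁾ = m⁽¹⁾ - 1.
    have hq1 : ∀ i, ∑ r ∈ G.rulesOf i, G.Q Y r 2 1 = 2 * G.moment Y 1 i - 2 := fun i => by
      have h1 := (hrec i).1
      rw [hp, StochasticCFG.expMatrix_mulVec] at h1
      have h2 : ∑ r ∈ G.rulesOf i, G.Q Y r 2 1 =
          2 * ∑ r ∈ G.rulesOf i, G.p r * G.additive (G.moment Y 1) r.output := by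
        rw [Finset.mul_sum]
        refine Finset.sum_congr rfl fun r hr => ?_
        rw [q1, hYi i r hr, StochasticCFG.additive_output]
        ring
      linarith
    have hc2 : ∀ i, G.c Y 2 i = G.CR Y i + 2 * G.moment Y 1 i - 1 := fun i => by
      rw [c2, hq0, hq1]
      ring
    refine ⟨hlen, fun i => ?_, e1', hq0, hq1, hc2, ?_⟩
    · rw [← e1']
      convert s1 i using 3 with π
      exact (hlen i π π.2).symm
    · rw [e2]
      congr 1
      exact funext hc2
  · have hlen : ∀ (i : G.NT) (π : List (ContextFreeRule T G.NT)) (u : List T),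
        G.Derives [Symbol.nonterminal i] π (u.map Symbol.terminal) →
          G.X Y π = (u.length : ℝ) := fun i π u hu' => StochasticCFG.X_eq_length_yield hY hu'
    refine ⟨hlen, fun i => ?_, ?_⟩
    · convert s1 i using 3 with π
      -- `hlen` covers every terminal string derived by `π`, so the choice made in `yield` is
      -- immaterial.
      exact (hlen i π _ π.2.choose_spec).symm
    · rw [e1]
      congr 1
      ext i
      rw [c1]
      exact Finset.sum_congr rfl fun r hr => by rw [hY r (StochasticCFG.mem_rulesOf.1 hr).1]
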